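/- **Modulation of memory decay.** Let $0<\alpha<1$ and $\lambda>0$, and let $\psi:\mathbb R\to\mathbb R$ satisfy $\psi(t)\to+\infty$ as $t\to+\infty$ (for instance, any strictly increasing $C^1$-diffeomorphism of $\mathbb R$ with $\psi'>0$, or $\psi(t)=e^{\gamma t}$ with $\gamma>0$). Let $$E_{\alpha,\alpha}(x)=\sum_{k=0}^{\infty}\frac{x^k}{\Gamma(\alpha k+\alpha)}$$ be the Mittag-Leffler function, and consider the memory kernel $$\mathcal K(t,\tau)=(\psi(t)-\psi(\tau))^{\alpha-1}E_{\alpha,\alpha}\bigl(-\lambda(\psi(t)-\psi(\tau))^{\alpha}\bigr)\qquad(\psi(t)>\psi(\tau)).$$ Put $C=-\dfrac{1}{\lambda^{2}\,\Gamma(-\alpha)}$. Then $C>0$ and, with $f\sim g$ meaning asymptotic equivalence $f-g=o(g)$ as $t\to+\infty$, $$\mathcal K(t,0)\sim C\,\psi(t)^{-(1+\alpha)}\qquad(t\to+\infty).$$ Moreover: 1. (Standard metric.) If $\psi(t)\sim t$, then $\mathcal K(t,0)=O\bigl(t^{-(1+\alpha)}\bigr)$ as $t\to+\infty$. 2. (Exponential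 aging, the "Amnesia Phenomenon".) If $\psi(t)\sim e^{\gamma t}$ for some $\gamma>0$, then $\mathcal K(t,0)=O\bigl(e^{-(1+\alpha)\gamma t}\bigr)$ as $t\to+\infty$. The same three assertions hold with $\mathcal K(t,0)$ replaced by $\psi(t)^{\alpha-1}E_{\alpha,\alpha}\bigl(-\lambda\psi(t)^{\alpha}\bigr)$, which is $\mathcal K(t,0)$ when $\psi(0)=0$. -/

import Mathlib

open Filter Asymptotics

/-- The two-parameter Mittag-Leffler function `E_{α,β}(x) = ∑_{k ≥ 0} x ^ k / Γ(α k + β)` at a real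
argument. -/
noncomputable def mittagLeffler (α β x : ℝ) : ℝ :=
  ∑' k : ℕ, x ^ k / Real.Gamma (α * k + β)

/-- For `s ≥ 1` and every `R > 0`, `Γ(s) ≥ exp (-R) * R ^ (s - 1)`. -/
theorem exp_neg_mul_rpow_le_Gamma {R s : ℝ} (hR : 0 < R) (hs : 1 ≤ s) :
    Real.exp (-R) * R ^ (s - 1) ≤ Real.Gamma s := by
  have hs0 : 0 < s := by linarith
  rw [Real.Gamma_eq_integral hs0]
  calc Real.exp (-R) * R ^ (s - 1) = ∫ x in Set.Ioi R, Real.exp (-x) * R ^ (s - 1) := by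
        rw [MeasureTheory.integral_mul_const, integral_exp_neg_Ioi]
    _ ≤ ∫ x in Set.Ioi R, Real.exp (-x) * x ^ (s - 1) := by
        refine MeasureTheory.setIntegral_mono_on ?_ ?_ measurableSet_Ioi ?_
        · exact (integrableOn_exp_neg_Ioi R).mul_const _
        · exact (Real.GammaIntegral_convergent hs0).mono_set (Set.Ioi_subset_Ioi hR.le)
        · intro x hx
          have hx' : R ≤ x := le_of_lt hx
          exact mul_le_mul_of_nonneg_left
            (Real.rpow_le_rpow hR.le hx' (by linarith)) (Real.exp_pos _).le
    _ ≤ ∫ x in Set.Ioi 0, Real.exp (-x) * x ^ (s - 1) := by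
        refine MeasureTheory.setIntegral_mono_set (Real.GammaIntegral_convergent hs0) ?_
          (Set.Ioi_subset_Ioi hR.le).eventuallyLE
        filter_upwards [MeasureTheory.ae_restrict_mem measurableSet_Ioi] with x hx
        exact mul_nonneg (Real.exp_pos _).le (Real.rpow_nonneg (le_of_lt hx) _)

/-- The Mittag-Leffler series converges for all `α > 0`, so that `mittagLeffler` is its sum. -/
theorem summable_mittagLeffler {α : ℝ} (hα : 0 < α) (β x : ℝ) :
    Summable fun k : ℕ => x ^ k / Real.Gamma (α * k + β) := by
  set R : ℝ := (2 * |x| + 1) ^ α⁻¹ with hRdef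
  have hb : 0 < 2 * |x| + 1 := by positivity
  have hR : 0 < R := Real.rpow_pos_of_pos hb _
  have hRα : R ^ α = 2 * |x| + 1 := Real.rpow_inv_rpow hb.le hα.ne'
  have hq : |x| / (2 * |x| + 1) < 1 := by
    rw [div_lt_one hb]; linarith [abs_nonneg x]
  have hgeo := (summable_geometric_of_lt_one (r := |x| / (2 * |x| + 1))
    (by positivity) hq).mul_left (Real.exp (-R) * R ^ (β - 1))⁻¹
  refine Summable.of_norm_bounded_eventually_nat hgeo ?_
  have hlim : Tendsto (fun k : ℕ => α * (k : ℝ) + β) atTop atTop :=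
    tendsto_atTop_add_const_right _ _
      (tendsto_natCast_atTop_atTop.const_mul_atTop hα)
  filter_upwards [hlim.eventually_ge_atTop 1] with k hk
  have h1 := exp_neg_mul_rpow_le_Gamma hR hk
  have hG : 0 < Real.Gamma (α * k + β) := Real.Gamma_pos_of_pos (by linarith)
  have h2 : R ^ (α * k + β - 1) = R ^ (β - 1) * (2 * |x| + 1) ^ k := by
    rw [show α * (k : ℝ) + β - 1 = (β - 1) + α * k by ring, Real.rpow_add hR,
      Real.rpow_mul hR.le, hRα, Real.rpow_natCast]
  rw [h2] at h1
  rw [norm_div, norm_pow, Real.norm_eq_abs, Real.norm_eq_abs, abs_of_pos hG, div_pow,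
    inv_mul_eq_div, div_div]
  refine div_le_div_of_nonneg_left (by positivity) (by positivity) ?_
  linarith

/-- The effective memory kernel
`K(t, τ) = (ψ(t) - ψ(τ)) ^ (α - 1) * E_{α,α}(-lam * (ψ(t) - ψ(τ)) ^ α)`. -/
noncomputable def memoryKernel (α lam : ℝ) (ψ : ℝ → ℝ) (t τ : ℝ) : ℝ :=
  (ψ t - ψ τ) ^ (α - 1) * mittagLeffler α α (-lam * (ψ t - ψ τ) ^ α)

/-!
The asymptotics of the kernel come from the behaviour of `E_{α,α}` at `-∞`: for `0 < α < 1`,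
`x ^ 2 * E_{α,α}(-x) → -1 / Γ(-α)` (`tendsto_sq_mul_mittagLeffler`). This is read off from the
spectral representation

  `π E_{α,α}(-λ) = sin (π α) ∫₀^∞ exp (-r) r ^ α / (λ ^ 2 + 2 λ r ^ α cos (π α) + r ^ (2 α)) dr`

(`mittagLeffler_eq_integral`) by dominated convergence as `λ → ∞`, since the integral times `λ ^ 2`
tends to `Γ(1 + α)` and `sin (π α) Γ(1 + α) = -π / Γ(-α)`. The denominator is at least
`(λ sin (π α)) ^ 2`, which gives the dominating function.

The representation is obtained by computing the Hankel contour integral of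
`exp ζ / (λ + ζ ^ α)` in two ways. Outside a large disc the geometric series in `ζ ^ (-α)` converges
uniformly, and Hankel's formula for `1 / Γ` (`hankelIntegral_exp_eq`) turns it into the
Mittag-Leffler series (`hankelIntegral_inv_add_exp`). On the other hand, `λ + ζ ^ α` has no zero in
the plane slit along the negative axis because `α < 1`, so that the contour may be collapsed onto
the slit, where only the jump of the integrand remains (`hankelIntegral_eq_integral_jump`).

All contour integrals are written in the coordinate `z = log ζ`. The slit plane becomes the strip
`|Im z| ≤ π`, the powers of `ζ` become exponentials without any choice of branch, and Cauchy's
theorem is needed for rectangles only. Hankel's formula itself follows from the same collapse for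
`0 < s < 1`, from the mean value property of `exp` for `s = 1`, and from the functional equation of
`Γ` beyond.

The modulation enters at the end only: the asymptotics are composed with
`t ↦ ψ t - ψ 0 ~ ψ t`, or with `ψ` itself, and equivalences pass through real powers.
-/

open MeasureTheory Set Topology

/-! ### The Gamma integral in logarithmic coordinates -/

theorem abs_exp_smul_gammaIntegrand (s x : ℝ) :
    |Real.exp x| • (Real.exp (-Real.exp x) * Real.exp x ^ (s - 1))
      = Real.exp (s * x - Real.exp x) := by
  rw [abs_of_pos (Real.exp_pos x), smul_eq_mul, ← Real.exp_mul, ← Real.exp_add, ← Real.exp_add]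
  congr 1
  ring

theorem integrable_exp_mul_sub_exp {s : ℝ} (hs : 0 < s) :
    Integrable fun x : ℝ => Real.exp (s * x - Real.exp x) := by
  have h := (integrableOn_image_iff_integrableOn_abs_deriv_smul MeasurableSet.univ
    (fun x _ => (Real.hasDerivAt_exp x).hasDerivWithinAt) Real.exp_injective.injOn
    (fun y => Real.exp (-y) * y ^ (s - 1))).1
    (by simpa only [image_univ, Real.range_exp] using Real.GammaIntegral_convergent hs)
  simpa only [abs_exp_smul_gammaIntegrand, integrableOn_univ] using h

theorem integral_exp_mul_sub_exp {s : ℝ} (hs : 0 < s) :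
    ∫ x : ℝ, Real.exp (s * x - Real.exp x) = Real.Gamma s := by
  have h := integral_image_eq_integral_abs_deriv_smul MeasurableSet.univ
    (fun x _ => (Real.hasDerivAt_exp x).hasDerivWithinAt) Real.exp_injective.injOn
    (fun y => Real.exp (-y) * y ^ (s - 1))
  simp only [abs_exp_smul_gammaIntegrand, image_univ, Real.range_exp, setIntegral_univ] at h
  rw [Real.Gamma_eq_integral hs, h]

/-- On a right half-line the decay of `exp (-exp x)` makes any exponent `s` admissible. -/
theorem integrableOn_exp_mul_sub_exp (s a : ℝ) :
    IntegrableOn (fun x : ℝ => Real.exp (s * x - Real.exp x)) (Ioi a) := by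
  refine Integrable.mono' (((integrable_exp_mul_sub_exp
    (s := |s| + 1) (by positivity)).integrableOn (s := Ioi a)).const_mul
      (Real.exp ((s - (|s| + 1)) * a))) (by fun_prop) ?_
  filter_upwards [ae_restrict_mem measurableSet_Ioi] with x hx
  rw [Real.norm_eq_abs, Real.abs_exp, ← Real.exp_add, Real.exp_le_exp]
  nlinarith [le_abs_self s, mem_Ioi.1 hx]

/-! ### Hankel contours in logarithmic coordinates -/

/-- The strip `|Im z| ≤ π` cut off at `a ≤ Re z`: under `z ↦ exp z` it covers the outside of a disc,
slit along the negative real axis. -/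
def halfStrip (a : ℝ) : Set ℂ := {z | a ≤ z.re ∧ |z.im| ≤ Real.pi}

/-- The contour integral `-i ∫ exp ζ * F ζ dζ` over the Hankel contour which comes in from `-∞`
below the negative real axis, turns around the circle `|ζ| = exp a` and goes back to `-∞` above the
axis. The integrand is given in the coordinate `z = log ζ` by `φ z = F (exp z)`, so that the contour
becomes the boundary of `halfStrip a`. On the two horizontal sides
`exp (exp z + z) = -exp (x - exp x)`. -/
noncomputable def hankelIntegral (a : ℝ) (φ : ℂ → ℂ) : ℂ :=
  (∫ y in (-Real.pi)..Real.pi,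
      Complex.exp (Complex.exp (a + y * Complex.I) + (a + y * Complex.I)) * φ (a + y * Complex.I))
    - Complex.I * ∫ x in Ioi a, (Real.exp (x - Real.exp x) : ℂ) *
        (φ (x + (-Real.pi : ℝ) * Complex.I) - φ (x + (Real.pi : ℝ) * Complex.I))

theorem norm_exp_exp_add_le (z : ℂ) :
    ‖Complex.exp (Complex.exp z + z)‖ ≤ Real.exp (Real.exp z.re + z.re) := by
  rw [Complex.norm_exp, Real.exp_le_exp, Complex.add_re]
  have := (Complex.re_le_norm (Complex.exp z)).trans_eq (Complex.norm_exp z)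
  linarith

theorem exp_exp_add_pi (x : ℝ) {σ : ℝ} (hσ : σ = Real.pi ∨ σ = -Real.pi) :
    Complex.exp (Complex.exp (x + σ * Complex.I) + (x + σ * Complex.I))
      = -(Real.exp (x - Real.exp x) : ℂ) := by
  have h : Complex.exp (σ * Complex.I) = -1 := by
    rcases hσ with rfl | rfl
    · exact Complex.exp_pi_mul_I
    · rw [Complex.ofReal_neg, neg_mul, Complex.exp_neg, Complex.exp_pi_mul_I]; norm_num
  have h2 : Complex.exp (x + σ * Complex.I) = -Complex.exp x := by
    rw [Complex.exp_add, h]; ring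
  rw [Complex.exp_add, h2]
  push_cast
  rw [Complex.exp_sub, Complex.exp_neg]
  field_simp

theorem mem_halfStrip_of_le {a x σ : ℝ} (hx : a ≤ x) (hσ : |σ| ≤ Real.pi) :
    (x + σ * Complex.I : ℂ) ∈ halfStrip a := by
  simpa [halfStrip] using ⟨hx, hσ⟩

theorem continuousOn_comp_horizontal {a σ : ℝ} {φ : ℂ → ℂ} (hφ : ContinuousOn φ (halfStrip a))
    (hσ : |σ| ≤ Real.pi) : ContinuousOn (fun x : ℝ => φ (x + σ * Complex.I)) (Ici a) :=
  hφ.comp (by fun_prop) fun _ hx => mem_halfStrip_of_le hx hσ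

theorem continuousOn_comp_vertical {a : ℝ} {φ : ℂ → ℂ} (hφ : ContinuousOn φ (halfStrip a)) :
    ContinuousOn (fun y : ℝ => φ (a + y * Complex.I)) (Icc (-Real.pi) Real.pi) :=
  hφ.comp (by fun_prop) fun _ hy => mem_halfStrip_of_le le_rfl (abs_le.2 hy)

theorem abs_pi_le : |Real.pi| ≤ Real.pi := (abs_of_pos Real.pi_pos).le

theorem abs_neg_pi_le : |-Real.pi| ≤ Real.pi := by rw [abs_neg]; exact abs_pi_le

theorem intervalIntegrable_hankel {a : ℝ} {φ : ℂ → ℂ} (hφ : ContinuousOn φ (halfStrip a)) :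
    IntervalIntegrable (fun y : ℝ =>
      Complex.exp (Complex.exp (a + y * Complex.I) + (a + y * Complex.I)) * φ (a + y * Complex.I))
      volume (-Real.pi) Real.pi := by
  refine ContinuousOn.intervalIntegrable ?_
  rw [uIcc_of_le (by linarith [Real.pi_pos])]
  exact ContinuousOn.mul (by fun_prop) (continuousOn_comp_vertical hφ)

/-- The jump of `φ` across the slit, weighted as in `hankelIntegral`, is dominated by a Gamma
integrand. -/
theorem norm_jump_le {b s M x : ℝ} {φ : ℂ → ℂ} (hx : b ≤ x)
    (hM : ∀ z ∈ halfStrip b, ‖φ z‖ ≤ M * Real.exp (-s * z.re)) :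
    ‖(Real.exp (x - Real.exp x) : ℂ) *
      (φ (x + (-Real.pi : ℝ) * Complex.I) - φ (x + (Real.pi : ℝ) * Complex.I))‖
      ≤ 2 * M * Real.exp ((1 - s) * x - Real.exp x) := by
  have h1 := hM _ (mem_halfStrip_of_le hx abs_neg_pi_le)
  have h2 := hM _ (mem_halfStrip_of_le hx abs_pi_le)
  have h3 := norm_sub_le (φ (x + (-Real.pi : ℝ) * Complex.I)) (φ (x + (Real.pi : ℝ) * Complex.I))
  simp only [Complex.add_re, Complex.ofReal_re, Complex.re_ofReal_mul, Complex.I_re, mul_zero,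
    add_zero] at h1 h2
  rw [norm_mul, Complex.norm_real, Real.norm_eq_abs, Real.abs_exp,
    show (1 - s) * x - Real.exp x = (x - Real.exp x) + -s * x by ring, Real.exp_add]
  calc _ ≤ Real.exp (x - Real.exp x) * (M * Real.exp (-s * x) + M * Real.exp (-s * x)) := by
        gcongr; linarith
    _ = _ := by ring

theorem continuousOn_jump {b : ℝ} {φ : ℂ → ℂ} (hφ : ContinuousOn φ (halfStrip b)) :
    ContinuousOn (fun x : ℝ => (Real.exp (x - Real.exp x) : ℂ) *
      (φ (x + (-Real.pi : ℝ) * Complex.I) - φ (x + (Real.pi : ℝ) * Complex.I))) (Ici b) :=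
  ContinuousOn.mul (by fun_prop)
    ((continuousOn_comp_horizontal hφ abs_neg_pi_le).sub
      (continuousOn_comp_horizontal hφ abs_pi_le))

theorem integrableOn_jump {a M : ℝ} {φ : ℂ → ℂ} (hφ : ContinuousOn φ (halfStrip a))
    (hM : ∀ z ∈ halfStrip a, ‖φ z‖ ≤ M) :
    IntegrableOn (fun x : ℝ => (Real.exp (x - Real.exp x) : ℂ) *
      (φ (x + (-Real.pi : ℝ) * Complex.I) - φ (x + (Real.pi : ℝ) * Complex.I))) (Ioi a) := by
  refine Integrable.mono' ((integrableOn_exp_mul_sub_exp (1 - 0) a).const_mul (2 * M))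
    (((continuousOn_jump hφ).mono Ioi_subset_Ici_self).aestronglyMeasurable measurableSet_Ioi) ?_
  filter_upwards [ae_restrict_mem measurableSet_Ioi] with x hx
  exact norm_jump_le (le_of_lt hx) (by simpa using hM)

theorem integrable_jump {s M : ℝ} (hs : s < 1) {φ : ℂ → ℂ}
    (hφ : ∀ b, ContinuousOn φ (halfStrip b))
    (hM : ∀ b, ∀ z ∈ halfStrip b, ‖φ z‖ ≤ M * Real.exp (-s * z.re)) :
    Integrable (fun x : ℝ => (Real.exp (x - Real.exp x) : ℂ) *
      (φ (x + (-Real.pi : ℝ) * Complex.I) - φ (x + (Real.pi : ℝ) * Complex.I))) := by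
  refine Integrable.mono' ((integrable_exp_mul_sub_exp (sub_pos.2 hs)).const_mul (2 * M)) ?_
    (Eventually.of_forall fun x => norm_jump_le (le_refl x) (hM x))
  refine (continuous_iff_continuousAt.2 fun x => ?_).aestronglyMeasurable
  exact (continuousOn_jump (hφ (x - 1))).continuousAt (Ici_mem_nhds (by linarith))

theorem hankelIntegral_congr {a : ℝ} {φ₁ φ₂ : ℂ → ℂ} (h : EqOn φ₁ φ₂ (halfStrip a)) :
    hankelIntegral a φ₁ = hankelIntegral a φ₂ := by
  unfold hankelIntegral
  congr 1
  · refine intervalIntegral.integral_congr fun y hy => ?_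
    rw [uIcc_of_le (by linarith [Real.pi_pos])] at hy
    rw [h (mem_halfStrip_of_le le_rfl (abs_le.2 hy))]
  · congr 1
    refine setIntegral_congr_fun measurableSet_Ioi fun x hx => ?_
    rw [h (mem_halfStrip_of_le (le_of_lt hx) abs_neg_pi_le),
      h (mem_halfStrip_of_le (le_of_lt hx) abs_pi_le)]

theorem hankelIntegral_add {a M₁ M₂ : ℝ} {φ₁ φ₂ : ℂ → ℂ}
    (h₁ : ContinuousOn φ₁ (halfStrip a)) (h₂ : ContinuousOn φ₂ (halfStrip a))
    (hM₁ : ∀ z ∈ halfStrip a, ‖φ₁ z‖ ≤ M₁) (hM₂ : ∀ z ∈ halfStrip a, ‖φ₂ z‖ ≤ M₂) :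
    hankelIntegral a (fun z => φ₁ z + φ₂ z) = hankelIntegral a φ₁ + hankelIntegral a φ₂ := by
  have hi₁ := integrableOn_jump h₁ hM₁
  have hi₂ := integrableOn_jump h₂ hM₂
  have e := integral_add hi₁ hi₂
  have e' := intervalIntegral.integral_add (intervalIntegrable_hankel h₁)
    (intervalIntegrable_hankel h₂)
  unfold hankelIntegral
  rw [show ∀ p q r t : ℂ, p - Complex.I * q + (r - Complex.I * t) = p + r - Complex.I * (q + t) by
    intros; ring, ← e, ← e']
  congr 2
  · ext y; ring
  · congr 1; ext x; ring

theorem hankelIntegral_const_mul (a : ℝ) (c : ℂ) (φ : ℂ → ℂ) :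
    hankelIntegral a (fun z => c * φ z) = c * hankelIntegral a φ := by
  unfold hankelIntegral
  rw [mul_sub, mul_left_comm c, ← intervalIntegral.integral_const_mul, ← integral_const_mul c]
  refine congrArg₂ _ (intervalIntegral.integral_congr fun y _ => ?_)
    (congrArg _ (integral_congr_ae (ae_of_all _ fun x => ?_))) <;> dsimp only <;> ring

theorem norm_hankelIntegral_le {a M : ℝ} {φ : ℂ → ℂ} (hM : ∀ z ∈ halfStrip a, ‖φ z‖ ≤ M) :
    ‖hankelIntegral a φ‖ ≤ (Real.exp (Real.exp a + a) * (2 * Real.pi)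
      + 2 * ∫ x in Ioi a, Real.exp (1 * x - Real.exp x)) * M := by
  have hpi := Real.pi_pos
  have hV : ‖∫ y in (-Real.pi)..Real.pi,
      Complex.exp (Complex.exp (a + y * Complex.I) + (a + y * Complex.I)) * φ (a + y * Complex.I)‖
      ≤ (Real.exp (Real.exp a + a) * M) * |Real.pi - -Real.pi| := by
    refine intervalIntegral.norm_integral_le_of_norm_le_const fun y hy => ?_
    rw [uIoc_of_le (by linarith)] at hy
    have h1 := norm_exp_exp_add_le (a + y * Complex.I)
    have h2 := hM _ (mem_halfStrip_of_le (le_refl a) (abs_le.2 ⟨hy.1.le, hy.2⟩))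
    simp only [Complex.add_re, Complex.ofReal_re, Complex.re_ofReal_mul, Complex.I_re, mul_zero,
      add_zero] at h1
    rw [norm_mul]
    gcongr
  have hR : ‖∫ x in Ioi a, (Real.exp (x - Real.exp x) : ℂ) *
        (φ (x + (-Real.pi : ℝ) * Complex.I) - φ (x + (Real.pi : ℝ) * Complex.I))‖
      ≤ ∫ x in Ioi a, (2 * M) * Real.exp (1 * x - Real.exp x) := by
    refine norm_integral_le_of_norm_le ((integrableOn_exp_mul_sub_exp 1 a).const_mul _) ?_
    filter_upwards [ae_restrict_mem measurableSet_Ioi] with x hx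
    have h1 := hM _ (mem_halfStrip_of_le (le_of_lt hx) abs_neg_pi_le)
    have h2 := hM _ (mem_halfStrip_of_le (le_of_lt hx) abs_pi_le)
    have h3 := norm_sub_le (φ (x + (-Real.pi : ℝ) * Complex.I)) (φ (x + (Real.pi : ℝ) * Complex.I))
    rw [norm_mul, Complex.norm_real, Real.norm_eq_abs, Real.abs_exp, one_mul, mul_comm (2 * M)]
    gcongr
    linarith
  rw [integral_const_mul] at hR
  rw [abs_of_pos (by linarith)] at hV
  refine (norm_sub_le _ _).trans ?_
  rw [norm_mul, Complex.norm_I, one_mul]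
  linarith

/-- The Hankel contour may be collapsed onto the slit when `φ` is holomorphic on the strip and grows
at most like `exp (-s Re z)` with `s < 1`: by Cauchy's theorem on the rectangle between `Re z = b`
and `Re z = a`, then `b → -∞`. -/
theorem hankelIntegral_eq_integral_jump {s M : ℝ} (hs : s < 1) {φ : ℂ → ℂ}
    (hφ : ∀ b, DifferentiableOn ℂ φ (halfStrip b))
    (hM : ∀ b, ∀ z ∈ halfStrip b, ‖φ z‖ ≤ M * Real.exp (-s * z.re)) (a : ℝ) :
    hankelIntegral a φ = -Complex.I * ∫ x : ℝ, (Real.exp (x - Real.exp x) : ℂ) *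
        (φ (x + (-Real.pi : ℝ) * Complex.I) - φ (x + (Real.pi : ℝ) * Complex.I)) := by
  set D : ℝ → ℂ := fun x => (Real.exp (x - Real.exp x) : ℂ) *
    (φ (x + (-Real.pi : ℝ) * Complex.I) - φ (x + (Real.pi : ℝ) * Complex.I)) with hD
  set V : ℝ → ℂ := fun b => ∫ y in (-Real.pi)..Real.pi,
    Complex.exp (Complex.exp (b + y * Complex.I) + (b + y * Complex.I)) * φ (b + y * Complex.I)
    with hV
  have hpi := Real.pi_pos
  have hDint : Integrable D := integrable_jump hs (fun b => (hφ b).continuousOn) hM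
  have hcauchy : ∀ b ≤ a, V a = V b - Complex.I * ∫ x in b..a, D x := by
    intro b hb
    have hR := Complex.integral_boundary_rect_eq_zero_of_differentiableOn
      (fun z => Complex.exp (Complex.exp z + z) * φ z)
      (⟨b, -Real.pi⟩ : ℂ) (⟨a, Real.pi⟩ : ℂ) (by
        refine DifferentiableOn.mul (by fun_prop) ((hφ b).mono ?_)
        intro z hz
        rw [Complex.mem_reProdIm, uIcc_of_le hb, uIcc_of_le (by simp; linarith)] at hz
        exact ⟨hz.1.1, abs_le.2 hz.2⟩)
    simp only [smul_eq_mul, exp_exp_add_pi _ (Or.inl rfl), exp_exp_add_pi _ (Or.inr rfl)] at hR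
    have hi : ∀ σ : ℝ, |σ| ≤ Real.pi → IntervalIntegrable
        (fun x : ℝ => -(Real.exp (x - Real.exp x) : ℂ) * φ (x + σ * Complex.I)) volume b a := by
      intro σ hσ
      refine ContinuousOn.intervalIntegrable ?_
      rw [uIcc_of_le hb]
      exact ContinuousOn.mul (by fun_prop)
        ((continuousOn_comp_horizontal (hφ b).continuousOn hσ).mono Icc_subset_Ici_self)
    rw [← intervalIntegral.integral_sub (hi _ abs_neg_pi_le) (hi _ abs_pi_le)] at hR
    have hDe : ∫ x in b..a, (-(Real.exp (x - Real.exp x) : ℂ) * φ (x + (-Real.pi : ℝ) * Complex.I)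
        - -(Real.exp (x - Real.exp x) : ℂ) * φ (x + (Real.pi : ℝ) * Complex.I))
        = -∫ x in b..a, D x := by
      rw [← intervalIntegral.integral_neg]
      congr 1; ext x; simp only [hD]; ring
    rw [hDe] at hR
    change -(∫ x in b..a, D x) + Complex.I * V a - Complex.I * V b = 0 at hR
    linear_combination (-Complex.I) * hR + (V a - V b) * Complex.I_mul_I
  have hV0 : Tendsto V atBot (𝓝 0) := by
    have hlim : Tendsto (fun b : ℝ => Real.exp (Real.exp b) * (M * Real.exp ((1 - s) * b))
        * |Real.pi - -Real.pi|) atBot (𝓝 0) := by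
      have h1 : Tendsto (fun b : ℝ => Real.exp (Real.exp b)) atBot (𝓝 1) := by
        simpa [Function.comp_def] using (Real.continuous_exp.tendsto 0).comp Real.tendsto_exp_atBot
      have h2 : Tendsto (fun b : ℝ => Real.exp ((1 - s) * b)) atBot (𝓝 0) :=
        Real.tendsto_exp_atBot.comp (tendsto_id.const_mul_atBot (sub_pos.2 hs))
      simpa using (h1.mul (h2.const_mul M)).mul_const |Real.pi - -Real.pi|
    refine squeeze_zero_norm (fun b => ?_) hlim
    refine intervalIntegral.norm_integral_le_of_norm_le_const fun y hy => ?_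
    rw [uIoc_of_le (by linarith)] at hy
    have h1 := norm_exp_exp_add_le (b + y * Complex.I)
    have h2 := hM b _ (mem_halfStrip_of_le (le_refl b) (abs_le.2 ⟨hy.1.le, hy.2⟩))
    simp only [Complex.add_re, Complex.ofReal_re, Complex.re_ofReal_mul, Complex.I_re, mul_zero,
      add_zero] at h1 h2
    rw [norm_mul]
    refine (mul_le_mul h1 h2 (norm_nonneg _) (Real.exp_pos _).le).trans_eq ?_
    rw [show (1 - s) * b = b + -s * b by ring, Real.exp_add, Real.exp_add]
    ring
  have hVa : V a = -Complex.I * ∫ x in Iic a, D x := by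
    have h1 := hV0.sub ((intervalIntegral_tendsto_integral_Iic a hDint.integrableOn
      tendsto_id).const_mul Complex.I)
    have h2 : Tendsto (fun _ : ℝ => V a) atBot (𝓝 (0 - Complex.I * ∫ x in Iic a, D x)) :=
      h1.congr' ((eventually_le_atBot a).mono fun b hb => (hcauchy b hb).symm)
    rw [tendsto_nhds_unique tendsto_const_nhds h2]
    ring
  change V a - Complex.I * (∫ x in Ioi a, D x) = _
  rw [hVa, ← intervalIntegral.integral_Iic_add_Ioi hDint.integrableOn hDint.integrableOn]
  ring

/-! ### Hankel's formula for the reciprocal Gamma function -/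

theorem exp_neg_mul_jump (s x : ℝ) :
    Complex.exp (-s * (x + (-Real.pi : ℝ) * Complex.I))
      - Complex.exp (-s * (x + (Real.pi : ℝ) * Complex.I))
      = 2 * Complex.I * ((Real.sin (Real.pi * s) * Real.exp (-s * x) : ℝ) : ℂ) := by
  have e1 : (-s * (x + (-Real.pi : ℝ) * Complex.I) : ℂ)
      = -s * x + (Real.pi * s) * Complex.I := by push_cast; ring
  have e2 : (-s * (x + (Real.pi : ℝ) * Complex.I) : ℂ)
      = -s * x + -(Real.pi * s) * Complex.I := by ring
  rw [e1, e2, Complex.exp_add, Complex.exp_add]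
  push_cast
  rw [Complex.sin]
  linear_combination (Complex.exp (-s * x) * (Complex.exp (Real.pi * s * Complex.I) -
    Complex.exp (-(Real.pi * s) * Complex.I))) * Complex.I_mul_I

theorem norm_exp_neg_mul (s : ℝ) (z : ℂ) : ‖Complex.exp (-s * z)‖ = Real.exp (-s * z.re) := by
  rw [Complex.norm_exp]
  simp

theorem norm_exp_neg_mul_le {s : ℝ} (hs : 0 ≤ s) {a : ℝ} {z : ℂ} (hz : z ∈ halfStrip a) :
    ‖Complex.exp (-s * z)‖ ≤ Real.exp (-s * a) := by
  rw [norm_exp_neg_mul, Real.exp_le_exp]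
  nlinarith [hz.1]

theorem hankelIntegral_exp (a s : ℝ) :
    hankelIntegral a (fun z => Complex.exp (-s * z))
      = (∫ y in (-Real.pi)..Real.pi, Complex.exp (Complex.exp (a + y * Complex.I)
          + (1 - s) * (a + y * Complex.I)))
        + ((2 * Real.sin (Real.pi * s) *
          ∫ x in Ioi a, Real.exp ((1 - s) * x - Real.exp x) : ℝ) : ℂ) := by
  unfold hankelIntegral
  rw [sub_eq_add_neg, Complex.ofReal_mul, ← integral_complex_ofReal, ← neg_mul,
    ← integral_const_mul, ← integral_const_mul]
  congr 1
  · congr 1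
    ext y
    rw [← Complex.exp_add]
    congr 1
    ring
  · congr 1
    ext x
    rw [exp_neg_mul_jump,
      show (1 - s) * x - Real.exp x = (x - Real.exp x) + -s * x by ring, Real.exp_add]
    push_cast
    linear_combination (-2 * Complex.exp (x - Complex.exp x) * Complex.sin (Real.pi * s)
      * Complex.exp (-s * x)) * Complex.I_mul_I

/-- Integration by parts along the contour: the functional equation of `1 / Γ`. -/
theorem hankelIntegral_exp_add_one {s : ℝ} (hs : 0 < s) (a : ℝ) :
    hankelIntegral a (fun z => Complex.exp (-s * z))
      = s * hankelIntegral a (fun z => Complex.exp (-(s + 1 : ℝ) * z)) := by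
  rw [hankelIntegral_exp, hankelIntegral_exp]
  set E : ℝ := Real.exp (-s * a - Real.exp a) with hE
  set S : ℝ := Real.sin (Real.pi * s) with hS
  have hS1 : Real.sin (Real.pi * (s + 1)) = -S := by
    rw [mul_add, mul_one, Real.sin_add_pi]
  have e1 : ∀ x : ℝ, (1 - (s + 1)) * x - Real.exp x = -s * x - Real.exp x := fun x => by ring
  -- the horizontal sides
  have hray : (∫ x in Ioi a, Real.exp ((1 - s) * x - Real.exp x))
      + s * ∫ x in Ioi a, Real.exp ((1 - (s + 1)) * x - Real.exp x) = E := by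
    have hi1 := integrableOn_exp_mul_sub_exp (1 - s) a
    have hi2 := (integrableOn_exp_mul_sub_exp (-s) a).const_mul s
    have hderiv : ∀ x ∈ Ici a, HasDerivAt (fun x => -Real.exp (-s * x - Real.exp x))
        (Real.exp ((1 - s) * x - Real.exp x) + s * Real.exp (-s * x - Real.exp x)) x := by
      intro x _
      have h := ((((hasDerivAt_id x).const_mul (-s)).sub (Real.hasDerivAt_exp x)).exp).neg
      refine h.congr_deriv ?_
      rw [show (1 - s) * x - Real.exp x = (-s * x - Real.exp x) + x by ring, Real.exp_add]
      simp only [Pi.sub_apply, id]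
      ring
    have hlim : Tendsto (fun x => -Real.exp (-s * x - Real.exp x)) atTop (𝓝 (-0)) := by
      refine (Real.tendsto_exp_atBot.comp ?_).neg
      refine tendsto_atBot_mono (fun x => ?_)
        ((tendsto_id.const_mul_atTop_of_neg (neg_lt_zero.2 hs)))
      have := Real.exp_pos x
      simp only [id]; linarith
    have h := integral_Ioi_of_hasDerivAt_of_tendsto' hderiv (hi1.add hi2) hlim
    simp only [e1]
    rw [← integral_const_mul, ← integral_add hi1 hi2, h, hE]
    ring
  -- the vertical side
  have hvert : (∫ y in (-Real.pi)..Real.pi, Complex.exp (Complex.exp (a + y * Complex.I)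
          + (1 - s) * (a + y * Complex.I)))
      - s * (∫ y in (-Real.pi)..Real.pi, Complex.exp (Complex.exp (a + y * Complex.I)
          + (1 - (s + 1 : ℝ)) * (a + y * Complex.I))) = -(2 * S * E : ℝ) := by
    have hderiv : ∀ y ∈ uIcc (-Real.pi) Real.pi, HasDerivAt
        (fun y : ℝ => -Complex.I * Complex.exp (Complex.exp (a + y * Complex.I)
          + -s * (a + y * Complex.I)))
        (Complex.exp (Complex.exp (a + y * Complex.I) + (1 - s) * (a + y * Complex.I))
          - s * Complex.exp (Complex.exp (a + y * Complex.I)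
            + (1 - (s + 1 : ℝ)) * (a + y * Complex.I))) y := by
      intro y _
      have h0 : HasDerivAt (fun y : ℝ => (a + y * Complex.I : ℂ)) Complex.I y := by
        simpa using ((hasDerivAt_id y).ofReal_comp.mul_const Complex.I).const_add (a : ℂ)
      have h := ((h0.cexp.add (h0.const_mul (-s : ℂ))).cexp).const_mul (-Complex.I)
      refine h.congr_deriv ?_
      rw [show Complex.exp (a + y * Complex.I) + (1 - s) * (a + y * Complex.I)
          = (Complex.exp (a + y * Complex.I) + -s * (a + y * Complex.I)) + (a + y * Complex.I) by
        ring, Complex.exp_add _ (a + y * Complex.I),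
        show (1 - (s + 1 : ℝ) : ℂ) = -s by push_cast; ring]
      simp only [Pi.add_apply]
      linear_combination (-Complex.exp (Complex.exp (a + y * Complex.I) + -s * (a + y * Complex.I))
        * (Complex.exp (a + y * Complex.I) - s)) * Complex.I_mul_I
    have hc1 : Continuous fun y : ℝ => Complex.exp (Complex.exp (a + y * Complex.I)
        + (1 - s) * (a + y * Complex.I)) := by fun_prop
    have hc2 : Continuous fun y : ℝ => s * Complex.exp (Complex.exp (a + y * Complex.I)
        + (1 - (s + 1 : ℝ)) * (a + y * Complex.I)) := by fun_prop
    have h := intervalIntegral.integral_eq_sub_of_hasDerivAt hderiv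
      ((hc1.sub hc2).intervalIntegrable _ _)
    rw [← intervalIntegral.integral_const_mul, ← intervalIntegral.integral_sub
      (hc1.intervalIntegrable _ _) (hc2.intervalIntegrable _ _), h]
    -- at both ends `exp (a ± iπ) = -exp a`
    have hb : ∀ σ : ℝ, σ = Real.pi ∨ σ = -Real.pi →
        Complex.exp (Complex.exp (a + σ * Complex.I) + -s * (a + σ * Complex.I))
          = Complex.exp (-Complex.exp a) * Complex.exp (-s * (a + σ * Complex.I)) := by
      intro σ hσ
      rw [Complex.exp_add]
      congr 2
      rcases hσ with rfl | rfl
      · rw [Complex.exp_add, Complex.exp_pi_mul_I]; ring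
      · rw [Complex.exp_add, Complex.ofReal_neg, neg_mul, Complex.exp_neg (_ * Complex.I),
          Complex.exp_pi_mul_I]
        norm_num
    rw [hb _ (Or.inl rfl), hb _ (Or.inr rfl)]
    have hj := exp_neg_mul_jump s a
    rw [hE, show -s * a - Real.exp a = -Real.exp a + -s * a by ring, Real.exp_add]
    have hSc : (S : ℂ) = Complex.sin (Real.pi * s) := by rw [hS]; push_cast; rfl
    push_cast at hj ⊢
    rw [hSc]
    linear_combination (Complex.I * Complex.exp (-Complex.exp a)) * hj
      + (2 * Complex.exp (-Complex.exp a) * Complex.exp (-s * a) * Complex.sin (Real.pi * s))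
        * Complex.I_mul_I
  rw [hS1]
  have hray' := congrArg (fun r : ℝ => (r : ℂ)) hray
  push_cast at hray' hvert ⊢
  linear_combination hvert + 2 * S * hray'

/-- For `0 < s < 1` the contour collapses onto the slit, and the reflection formula applies. -/
theorem hankelIntegral_exp_of_lt_one {s : ℝ} (hs0 : 0 < s) (hs1 : s < 1) (a : ℝ) :
    hankelIntegral a (fun z => Complex.exp (-s * z)) = (2 * Real.pi / Real.Gamma s : ℝ) := by
  rw [hankelIntegral_eq_integral_jump (s := s) (M := 1) hs1 (fun b => by fun_prop)
    (fun b z _ => by rw [one_mul, norm_exp_neg_mul])]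
  have e : ∀ x : ℝ, (Real.exp (x - Real.exp x) : ℂ) *
      (Complex.exp (-s * (x + (-Real.pi : ℝ) * Complex.I))
      - Complex.exp (-s * (x + (Real.pi : ℝ) * Complex.I)))
      = (2 * Complex.I * Real.sin (Real.pi * s)) *
        ((Real.exp ((1 - s) * x - Real.exp x) : ℝ) : ℂ) := by
    intro x
    rw [exp_neg_mul_jump,
      show (1 - s) * x - Real.exp x = (x - Real.exp x) + -s * x by ring, Real.exp_add]
    push_cast; ring
  simp_rw [e]
  rw [integral_const_mul, integral_complex_ofReal, integral_exp_mul_sub_exp (sub_pos.2 hs1)]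
  have hG := Real.Gamma_mul_Gamma_one_sub s
  have hS : 0 < Real.sin (Real.pi * s) := Real.sin_pos_of_pos_of_lt_pi
    (by have := Real.pi_pos; positivity) (by nlinarith [Real.pi_pos])
  have hGs := Real.Gamma_pos_of_pos hs0
  have : 2 * Real.sin (Real.pi * s) * Real.Gamma (1 - s) = 2 * Real.pi / Real.Gamma s := by
    rw [eq_div_iff hS.ne'] at hG
    rw [eq_div_iff hGs.ne']
    linear_combination 2 * hG
  rw [← this]
  push_cast
  linear_combination (-2 * Complex.sin (Real.pi * s) * Real.Gamma (1 - s)) * Complex.I_mul_I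

/-- For `s = 1` the two horizontal sides cancel, and the mean value property of `exp` on the circle
`|ζ| = exp a` remains. -/
theorem hankelIntegral_exp_one (a : ℝ) :
    hankelIntegral a (fun z => Complex.exp (-(1 : ℝ) * z)) = 2 * Real.pi := by
  rw [hankelIntegral_exp]
  have h : Real.circleAverage Complex.exp 0 (Real.exp a) = Complex.exp 0 :=
    DiffContOnCl.circleAverage Complex.differentiable_exp.diffContOnCl
  have hper : Function.Periodic
      (fun θ : ℝ => Complex.exp (circleMap 0 (Real.exp a) θ)) (2 * Real.pi) :=
    (periodic_circleMap 0 (Real.exp a)).comp _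
  have hshift := hper.intervalIntegral_add_eq 0 (-Real.pi)
  rw [zero_add, show -Real.pi + 2 * Real.pi = Real.pi by ring] at hshift
  have hpi : 2 * Real.pi ≠ 0 := by have := Real.pi_pos; positivity
  rw [Real.circleAverage_def, hshift, Complex.exp_zero, inv_smul_eq_iff₀ hpi,
    Complex.real_smul, mul_one] at h
  simp only [mul_one, Real.sin_pi, mul_zero, zero_mul, Complex.ofReal_zero, add_zero,
    Complex.ofReal_one, sub_self]
  push_cast at h
  rw [← h]
  congr 1
  ext y
  rw [circleMap, zero_add, Complex.exp_add, Complex.ofReal_exp]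

/-- **Hankel's formula** for `1 / Γ`: the functional equation carries it from `(0, 1]` to all
`s > 0`. -/
theorem hankelIntegral_exp_eq {s : ℝ} (hs : 0 < s) (a : ℝ) :
    hankelIntegral a (fun z => Complex.exp (-s * z)) = (2 * Real.pi / Real.Gamma s : ℝ) := by
  obtain ⟨n, hn⟩ := exists_nat_ge s
  induction n generalizing s with
  | zero => simp at hn; linarith
  | succ n ih =>
    rcases lt_trichotomy s 1 with h | rfl | h
    · exact hankelIntegral_exp_of_lt_one hs h a
    · rw [hankelIntegral_exp_one]; simp
    · have h0 : 0 < s - 1 := by linarith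
      have h1 := hankelIntegral_exp_add_one h0 a
      rw [ih h0 (by push_cast at hn; linarith), sub_add_cancel] at h1
      have hG := Real.Gamma_add_one h0.ne'
      rw [sub_add_cancel] at hG
      have hp := Real.Gamma_pos_of_pos h0
      have h0' : ((s - 1 : ℝ) : ℂ) ≠ 0 := by exact_mod_cast h0.ne'
      refine mul_left_cancel₀ h0' (h1.symm.trans ?_)
      rw [← Complex.ofReal_mul, hG]
      congr 1
      field_simp

/-! ### The Mittag-Leffler function on the negative half-line -/

theorem quadratic_lower_bound (lam r α : ℝ) :
    (lam * Real.sin (Real.pi * α)) ^ 2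
      ≤ lam ^ 2 + 2 * lam * r * Real.cos (Real.pi * α) + r ^ 2 := by
  nlinarith [sq_nonneg (r + lam * Real.cos (Real.pi * α)), Real.sin_sq_add_cos_sq (Real.pi * α)]

theorem sin_pi_mul_pos {α : ℝ} (hα0 : 0 < α) (hα1 : α < 1) : 0 < Real.sin (Real.pi * α) :=
  Real.sin_pos_of_pos_of_lt_pi (by have := Real.pi_pos; positivity) (by nlinarith [Real.pi_pos])

/-- Since `exp (α z)` stays in the sector `|arg| ≤ π α`, with `α < 1`, the denominator of the
Mittag-Leffler integrand keeps away from zero. -/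
theorem mul_sin_le_norm_add_exp {α lam : ℝ} (hα0 : 0 < α) (hα1 : α < 1) (hlam : 0 < lam)
    {a : ℝ} {z : ℂ} (hz : z ∈ halfStrip a) :
    lam * Real.sin (Real.pi * α) ≤ ‖(lam + Complex.exp (α * z) : ℂ)‖ := by
  have hcos : Real.cos (Real.pi * α) ≤ Real.cos (α * z.im) := by
    rw [← Real.cos_abs (α * z.im), abs_mul, abs_of_pos hα0]
    refine Real.cos_le_cos_of_nonneg_of_le_pi (by positivity) ?_ ?_
    · nlinarith [Real.pi_pos]
    · nlinarith [hz.2]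
  refine abs_le_of_sq_le_sq' ?_ (norm_nonneg _) |>.2
  rw [← Complex.normSq_eq_norm_sq, Complex.normSq_apply]
  have hre : (Complex.exp (α * z)).re = Real.exp (α * z.re) * Real.cos (α * z.im) := by
    rw [Complex.exp_re]; simp
  have him : (Complex.exp (α * z)).im = Real.exp (α * z.re) * Real.sin (α * z.im) := by
    rw [Complex.exp_im]; simp
  simp only [Complex.add_re, Complex.add_im, Complex.ofReal_re, Complex.ofReal_im, zero_add,
    hre, him]
  set r := Real.exp (α * z.re)
  have hr : 0 < r := Real.exp_pos _
  calc _ ≤ lam ^ 2 + 2 * lam * r * Real.cos (Real.pi * α) + r ^ 2 := quadratic_lower_bound _ _ _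
    _ ≤ lam ^ 2 + 2 * lam * r * Real.cos (α * z.im) + r ^ 2 := by gcongr
    _ = _ := by linear_combination (-r ^ 2) * Real.sin_sq_add_cos_sq (α * z.im)

theorem add_exp_ne_zero {α lam : ℝ} (hα0 : 0 < α) (hα1 : α < 1) (hlam : 0 < lam)
    {a : ℝ} {z : ℂ} (hz : z ∈ halfStrip a) : (lam + Complex.exp (α * z) : ℂ) ≠ 0 := by
  have := mul_sin_le_norm_add_exp hα0 hα1 hlam hz
  have := mul_pos hlam (sin_pi_mul_pos hα0 hα1)
  exact norm_pos_iff.1 (by linarith)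

theorem differentiableOn_inv_add_exp {α lam : ℝ} (hα0 : 0 < α) (hα1 : α < 1) (hlam : 0 < lam)
    (a : ℝ) : DifferentiableOn ℂ (fun z => (lam + Complex.exp (α * z) : ℂ)⁻¹) (halfStrip a) :=
  DifferentiableOn.inv (by fun_prop) fun _ hz => add_exp_ne_zero hα0 hα1 hlam hz

theorem norm_inv_add_exp_le {α lam : ℝ} (hα0 : 0 < α) (hα1 : α < 1) (hlam : 0 < lam)
    {a : ℝ} {z : ℂ} (hz : z ∈ halfStrip a) :
    ‖(lam + Complex.exp (α * z) : ℂ)⁻¹‖ ≤ (lam * Real.sin (Real.pi * α))⁻¹ := by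
  rw [norm_inv]
  exact inv_anti₀ (mul_pos hlam (sin_pi_mul_pos hα0 hα1))
    (mul_sin_le_norm_add_exp hα0 hα1 hlam hz)

/-- The remainder after `n` terms of the geometric expansion of `1 / (lam + exp (α z))` in powers of
`exp (-α z)`. -/
noncomputable def geomRemainder (α lam : ℝ) (n : ℕ) (z : ℂ) : ℂ :=
  (-lam * Complex.exp (-α * z)) ^ n * (lam + Complex.exp (α * z))⁻¹

theorem continuousOn_geomRemainder {α lam : ℝ} (hα0 : 0 < α) (hα1 : α < 1) (hlam : 0 < lam)
    (n : ℕ) (a : ℝ) : ContinuousOn (geomRemainder α lam n) (halfStrip a) :=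
  ContinuousOn.mul (by fun_prop) (differentiableOn_inv_add_exp hα0 hα1 hlam a).continuousOn

theorem norm_geomRemainder_le {α lam : ℝ} (hα0 : 0 < α) (hα1 : α < 1) (hlam : 0 < lam)
    (n : ℕ) {a : ℝ} {z : ℂ} (hz : z ∈ halfStrip a) :
    ‖geomRemainder α lam n z‖
      ≤ (lam * Real.exp (-α * a)) ^ n * (lam * Real.sin (Real.pi * α))⁻¹ := by
  have h := norm_exp_neg_mul_le hα0.le hz
  rw [geomRemainder, norm_mul, norm_pow, norm_mul, norm_neg, Complex.norm_real,
    Real.norm_of_nonneg hlam.le]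
  gcongr
  exact norm_inv_add_exp_le hα0 hα1 hlam hz

theorem geomRemainder_eq {α lam : ℝ} (hα0 : 0 < α) (hα1 : α < 1) (hlam : 0 < lam)
    (n : ℕ) {a : ℝ} {z : ℂ} (hz : z ∈ halfStrip a) :
    geomRemainder α lam n z = (-lam : ℂ) ^ n * Complex.exp (-(α * n + α : ℝ) * z)
      + geomRemainder α lam (n + 1) z := by
  have h0 := add_exp_ne_zero hα0 hα1 hlam hz
  have h1 : Complex.exp (-α * z) * Complex.exp (α * z) = 1 := by
    rw [← Complex.exp_add]; simp
  have h2 : Complex.exp (-(α * n + α : ℝ) * z)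
      = Complex.exp (-α * z) ^ n * Complex.exp (-α * z) := by
    rw [← Complex.exp_nat_mul, ← Complex.exp_add]
    congr 1; push_cast; ring
  rw [geomRemainder, geomRemainder, h2]
  linear_combination (-lam * Complex.exp (-α * z)) ^ n * Complex.exp (-α * z) * mul_inv_cancel₀ h0
    - (-lam * Complex.exp (-α * z)) ^ n * (lam + Complex.exp (α * z))⁻¹ * h1

/-- The first `n` terms of the geometric expansion, integrated by Hankel's formula, are those of the
Mittag-Leffler series. -/
theorem hankelIntegral_geomRemainder_zero {α lam : ℝ} (hα0 : 0 < α) (hα1 : α < 1)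
    (hlam : 0 < lam) (a : ℝ) (n : ℕ) :
    hankelIntegral a (geomRemainder α lam 0)
      = ((2 * Real.pi * ∑ k ∈ Finset.range n, (-lam) ^ k / Real.Gamma (α * k + α) : ℝ) : ℂ)
        + hankelIntegral a (geomRemainder α lam n) := by
  induction n with
  | zero => simp
  | succ n ih =>
    have hs : 0 < α * n + α := by positivity
    rw [ih, hankelIntegral_congr fun z hz => geomRemainder_eq hα0 hα1 hlam n hz,
      hankelIntegral_add (M₁ := lam ^ n * Real.exp (-(α * n + α) * a))
        (M₂ := (lam * Real.exp (-α * a)) ^ (n + 1) * (lam * Real.sin (Real.pi * α))⁻¹)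
        (by fun_prop) (continuousOn_geomRemainder hα0 hα1 hlam _ _) ?_
        (fun z hz => norm_geomRemainder_le hα0 hα1 hlam _ hz),
      hankelIntegral_const_mul, hankelIntegral_exp_eq hs, Finset.sum_range_succ]
    · push_cast; ring
    · intro z hz
      rw [norm_mul, norm_pow, norm_neg, Complex.norm_real, Real.norm_of_nonneg hlam.le]
      gcongr
      exact norm_exp_neg_mul_le hs.le hz

/-- The Mittag-Leffler function as a Hankel integral. The contour keeps outside the disc of radius
`(2 lam) ^ (1 / α)`, where the geometric expansion converges. -/
theorem hankelIntegral_inv_add_exp {α lam : ℝ} (hα0 : 0 < α) (hα1 : α < 1) (hlam : 0 < lam) :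
    hankelIntegral (Real.log (2 * lam) / α) (fun z => (lam + Complex.exp (α * z) : ℂ)⁻¹)
      = (2 * Real.pi * mittagLeffler α α (-lam) : ℝ) := by
  set a := Real.log (2 * lam) / α with ha
  have hhalf : lam * Real.exp (-α * a) = 1 / 2 := by
    rw [ha, neg_mul, mul_div_cancel₀ _ hα0.ne', Real.exp_neg, Real.exp_log (by positivity)]
    field_simp
  have h0 : hankelIntegral a (fun z => (lam + Complex.exp (α * z) : ℂ)⁻¹)
      = hankelIntegral a (geomRemainder α lam 0) := by
    congr 1; ext z; simp [geomRemainder]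
  rw [h0]
  have hsum := (summable_mittagLeffler hα0 α (-lam)).hasSum.tendsto_sum_nat
  have hrem : Tendsto (fun n => hankelIntegral a (geomRemainder α lam n)) atTop (𝓝 0) := by
    refine squeeze_zero_norm (fun n => norm_hankelIntegral_le
      fun z hz => norm_geomRemainder_le hα0 hα1 hlam n hz) ?_
    rw [hhalf]
    simpa using ((tendsto_pow_atTop_nhds_zero_of_lt_one (r := (1 / 2 : ℝ)) (by norm_num)
      (by norm_num)).mul_const _).const_mul _
  have hlim := ((Complex.continuous_ofReal.tendsto _).comp
    (hsum.const_mul (2 * Real.pi))).add hrem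
  rw [add_zero] at hlim
  exact tendsto_nhds_unique tendsto_const_nhds
    (hlim.congr fun n => (hankelIntegral_geomRemainder_zero hα0 hα1 hlam a n).symm)

theorem inv_add_exp_jump {α lam : ℝ} (hα0 : 0 < α) (hα1 : α < 1) (hlam : 0 < lam) (x : ℝ) :
    (lam + Complex.exp (α * (x + (-Real.pi : ℝ) * Complex.I)) : ℂ)⁻¹
      - (lam + Complex.exp (α * (x + (Real.pi : ℝ) * Complex.I)) : ℂ)⁻¹
      = 2 * Complex.I * ((Real.sin (Real.pi * α) * Real.exp (α * x) /
          (lam ^ 2 + 2 * lam * Real.exp (α * x) * Real.cos (Real.pi * α)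
            + Real.exp (α * x) ^ 2) : ℝ) : ℂ) := by
  have h1 := add_exp_ne_zero hα0 hα1 hlam (mem_halfStrip_of_le (le_refl x) abs_neg_pi_le)
  have h2 := add_exp_ne_zero hα0 hα1 hlam (mem_halfStrip_of_le (le_refl x) abs_pi_le)
  have e : ∀ σ : ℝ, Complex.exp (α * (x + σ * Complex.I))
      = Complex.exp (α * x) * (Complex.cos (σ * α) + Complex.sin (σ * α) * Complex.I) := by
    intro σ
    rw [← Complex.exp_mul_I, ← Complex.exp_add]
    congr 1; ring
  have hq : (0 : ℝ) < lam ^ 2 + 2 * lam * Real.exp (α * x) * Real.cos (Real.pi * α)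
      + Real.exp (α * x) ^ 2 :=
    (by have := mul_pos hlam (sin_pi_mul_pos hα0 hα1); positivity : (0 : ℝ) < _).trans_le
      (quadratic_lower_bound lam (Real.exp (α * x)) α)
  have hq' := Complex.ofReal_ne_zero.2 hq.ne'
  rw [inv_sub_inv h1 h2, Complex.ofReal_div, mul_div_assoc', div_eq_div_iff (mul_ne_zero h1 h2) hq',
    e, e]
  push_cast
  rw [neg_mul, Complex.cos_neg, Complex.sin_neg]
  have hsc := Complex.sin_sq_add_cos_sq (Real.pi * α)
  set c := Complex.cos (Real.pi * α)
  set S := Complex.sin (Real.pi * α)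
  set r := Complex.exp (α * x)
  linear_combination (2 * S ^ 3 * r ^ 3 * Complex.I) * Complex.I_mul_I
    + (-2 * Complex.I * S * r ^ 3) * hsc

/-- The spectral representation of the Mittag-Leffler function, written with `r = exp x`. -/
theorem mittagLeffler_eq_integral {α lam : ℝ} (hα0 : 0 < α) (hα1 : α < 1) (hlam : 0 < lam) :
    Real.pi * mittagLeffler α α (-lam) = Real.sin (Real.pi * α) *
      ∫ x : ℝ, Real.exp ((1 + α) * x - Real.exp x) /
        (lam ^ 2 + 2 * lam * Real.exp (α * x) * Real.cos (Real.pi * α)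
            + Real.exp (α * x) ^ 2) := by
  have h := hankelIntegral_inv_add_exp hα0 hα1 hlam
  rw [hankelIntegral_eq_integral_jump (s := 0) (M := (lam * Real.sin (Real.pi * α))⁻¹) one_pos
    (differentiableOn_inv_add_exp hα0 hα1 hlam)
    (fun b z hz => by simpa using norm_inv_add_exp_le hα0 hα1 hlam hz)] at h
  have e : ∀ x : ℝ, (Real.exp (x - Real.exp x) : ℂ) *
      ((lam + Complex.exp (α * (x + (-Real.pi : ℝ) * Complex.I)) : ℂ)⁻¹
      - (lam + Complex.exp (α * (x + (Real.pi : ℝ) * Complex.I)) : ℂ)⁻¹)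
      = (2 * Complex.I * Real.sin (Real.pi * α)) *
        ((Real.exp ((1 + α) * x - Real.exp x) /
        (lam ^ 2 + 2 * lam * Real.exp (α * x) * Real.cos (Real.pi * α)
            + Real.exp (α * x) ^ 2) : ℝ) : ℂ) := by
    intro x
    rw [inv_add_exp_jump hα0 hα1 hlam,
      show (1 + α) * x - Real.exp x = (x - Real.exp x) + α * x by ring, Real.exp_add]
    push_cast; ring
  simp_rw [e] at h
  rw [integral_const_mul, integral_complex_ofReal] at h
  set J := ∫ x : ℝ, Real.exp ((1 + α) * x - Real.exp x) /
        (lam ^ 2 + 2 * lam * Real.exp (α * x) * Real.cos (Real.pi * α)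
            + Real.exp (α * x) ^ 2)
  have h' : ((2 * (Real.sin (Real.pi * α) * J) : ℝ) : ℂ)
      = ((2 * (Real.pi * mittagLeffler α α (-lam)) : ℝ) : ℂ) := by
    push_cast at h ⊢
    linear_combination h + (2 * Complex.sin (Real.pi * α) * J) * Complex.I_mul_I
  have := Complex.ofReal_injective h'
  linarith

/-- The reflection formula, in the form that turns the limit of the spectral integral into the
constant of the asymptotics. -/
theorem sin_mul_Gamma_one_add {α : ℝ} (hα0 : 0 < α) (hα1 : α < 1) :
    Real.sin (Real.pi * α) * Real.Gamma (1 + α) = Real.pi * (-1 / Real.Gamma (-α)) := by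
  have h1 := Real.Gamma_mul_Gamma_one_sub α
  have h2 := Real.Gamma_add_one hα0.ne'
  have h3 := Real.Gamma_add_one (neg_ne_zero.2 hα0.ne')
  have h4 : 0 < Real.Gamma (-α + 1) := Real.Gamma_pos_of_pos (by linarith)
  have h5 : Real.Gamma (-α) ≠ 0 := by
    intro h; rw [h, mul_zero] at h3; exact h4.ne' h3
  have hS := sin_pi_mul_pos hα0 hα1
  rw [show 1 - α = -α + 1 by ring, eq_div_iff hS.ne', h3] at h1
  rw [add_comm 1 α, h2, mul_div_assoc', eq_div_iff h5]
  linear_combination -h1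

theorem neg_one_div_Gamma_neg_pos {α : ℝ} (hα0 : 0 < α) (hα1 : α < 1) :
    0 < -1 / Real.Gamma (-α) := by
  have h := sin_mul_Gamma_one_add hα0 hα1
  have h1 : 0 < Real.sin (Real.pi * α) * Real.Gamma (1 + α) :=
    mul_pos (sin_pi_mul_pos hα0 hα1) (Real.Gamma_pos_of_pos (by linarith))
  rw [h] at h1
  exact (pos_iff_pos_of_mul_pos h1).1 Real.pi_pos

/-- The leading term at `-∞`. The general expansion is `-∑ (-x) ^ (-k) / Γ (α - α k)`; its term
`k = 1` is absent because `1 / Γ` vanishes at `0`, so `k = 2` leads. Multiplied by `x ^ 2`, the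
spectral integrand is dominated by a multiple of the Gamma integrand of `Γ (1 + α)`. -/
theorem tendsto_sq_mul_mittagLeffler {α : ℝ} (hα0 : 0 < α) (hα1 : α < 1) :
    Tendsto (fun x : ℝ => x ^ 2 * mittagLeffler α α (-x)) atTop (𝓝 (-1 / Real.Gamma (-α))) := by
  have hS := sin_pi_mul_pos hα0 hα1
  have hlim : Tendsto (fun lam : ℝ => ∫ x : ℝ, Real.exp ((1 + α) * x - Real.exp x) * (lam ^ 2 /
        (lam ^ 2 + 2 * lam * Real.exp (α * x) * Real.cos (Real.pi * α)
            + Real.exp (α * x) ^ 2))) atTop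
      (𝓝 (∫ x : ℝ, Real.exp ((1 + α) * x - Real.exp x))) := by
    refine tendsto_integral_filter_of_dominated_convergence
      (fun x => Real.exp ((1 + α) * x - Real.exp x) * (Real.sin (Real.pi * α) ^ 2)⁻¹) ?_ ?_
      ((integrable_exp_mul_sub_exp (by linarith)).mul_const _) ?_
    · exact Eventually.of_forall fun lam => Measurable.aestronglyMeasurable (by fun_prop)
    · filter_upwards [eventually_gt_atTop 0] with lam hlam
      refine Eventually.of_forall fun x => ?_
      have hb := quadratic_lower_bound lam (Real.exp (α * x)) α
      have hpos : 0 < (lam * Real.sin (Real.pi * α)) ^ 2 := by positivity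
      rw [Real.norm_of_nonneg
        (mul_nonneg (Real.exp_pos _).le (div_nonneg (sq_nonneg _) (hpos.le.trans hb)))]
      gcongr
      calc _ ≤ lam ^ 2 / (lam * Real.sin (Real.pi * α)) ^ 2 := by gcongr
        _ = _ := by field_simp
    · refine Eventually.of_forall fun x => ?_
      set r := Real.exp (α * x)
      have h1 : Tendsto (fun lam : ℝ => r / lam) atTop (𝓝 0) :=
        tendsto_const_nhds.div_atTop tendsto_id
      have h2 : Tendsto (fun lam : ℝ => Real.exp ((1 + α) * x - Real.exp x) *
          (1 + 2 * (r / lam) * Real.cos (Real.pi * α) + (r / lam) ^ 2)⁻¹) atTop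
          (𝓝 (Real.exp ((1 + α) * x - Real.exp x) *
          (1 + 2 * 0 * Real.cos (Real.pi * α) + 0 ^ 2)⁻¹)) :=
        (((((h1.const_mul 2).mul_const _).const_add 1).add (h1.pow 2)).inv₀
          (by norm_num)).const_mul _
      simp only [mul_zero, zero_mul, add_zero, ne_eq, OfNat.ofNat_ne_zero, not_false_eq_true,
        zero_pow, inv_one, mul_one] at h2
      refine h2.congr' ?_
      filter_upwards [eventually_gt_atTop 0] with lam hlam
      rw [show lam ^ 2 + 2 * lam * r * Real.cos (Real.pi * α) + r ^ 2 = lam ^ 2 *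
        (1 + 2 * (r / lam) * Real.cos (Real.pi * α) + (r / lam) ^ 2) by field_simp,
        ← div_div, div_self (by positivity), one_div]
  rw [integral_exp_mul_sub_exp (by linarith)] at hlim
  have hlim' := (hlim.const_mul (Real.sin (Real.pi * α))).const_mul Real.pi⁻¹
  rw [sin_mul_Gamma_one_add hα0 hα1, inv_mul_cancel_left₀ Real.pi_ne_zero] at hlim'
  refine hlim'.congr' ?_
  filter_upwards [eventually_gt_atTop 0] with lam hlam
  have h := mittagLeffler_eq_integral hα0 hα1 hlam
  rw [inv_mul_eq_iff_eq_mul₀ Real.pi_ne_zero, mul_left_comm, h, mul_left_comm (lam ^ 2)]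
  congr 1
  rw [← integral_const_mul]
  congr 1; ext x; ring

/-! ### Modulated memory kernels -/

theorem isEquivalent_rpow_mul_mittagLeffler {α lam : ℝ} (hα0 : 0 < α) (hα1 : α < 1)
    (hlam : 0 < lam) :
    (fun u : ℝ => u ^ (α - 1) * mittagLeffler α α (-lam * u ^ α)) ~[atTop]
      fun u => -1 / (Real.Gamma (-α) * lam ^ 2) * u ^ (-(1 + α)) := by
  have hC := neg_one_div_Gamma_neg_pos hα0 hα1
  have hu : Tendsto (fun u : ℝ => lam * u ^ α) atTop atTop :=
    (tendsto_rpow_atTop hα0).const_mul_atTop hlam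
  have hE : (fun u : ℝ => (lam * u ^ α) ^ 2 * mittagLeffler α α (-(lam * u ^ α))) ~[atTop]
      fun _ => -1 / Real.Gamma (-α) :=
    (isEquivalent_const_iff_tendsto hC.ne').2 ((tendsto_sq_mul_mittagLeffler hα0 hα1).comp hu)
  have h := (IsEquivalent.refl (u := fun u : ℝ => (lam ^ 2)⁻¹ * u ^ (-(1 + α)))
    (l := atTop)).mul hE
  refine (h.congr_left ?_).congr_right ?_
  · filter_upwards [eventually_gt_atTop 0] with u hu
    rw [Pi.mul_apply, neg_mul, show α - 1 = -(1 + α) + α + α by ring, Real.rpow_add hu,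
      Real.rpow_add hu]
    field_simp
  · refine Eventually.of_forall fun u => ?_
    rw [Pi.mul_apply, ← div_div]
    ring

/-- Unlike in `Asymptotics.IsEquivalent.rpow`, the function `g` is only eventually nonnegative. -/
theorem isEquivalent_rpow_of_tendsto_atTop {f g : ℝ → ℝ} {p : ℝ} (hg : Tendsto g atTop atTop)
    (h : f ~[atTop] g) : (fun t => f t ^ p) ~[atTop] fun t => g t ^ p := by
  have habs : (fun t => |g t|) =ᶠ[atTop] g :=
    (hg.eventually_ge_atTop 0).mono fun t ht => abs_of_nonneg ht
  have h1 : f ~[atTop] fun t => |g t| := h.congr_right habs.symm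
  exact (h1.rpow (r := p) (fun t => abs_nonneg (g t))).congr_right
    (habs.mono fun t ht => congrArg (· ^ p) ht)

/-- The kernel asymptotics for any modulation `u` tending to infinity, transported to an equivalent
modulation `ψ`. -/
theorem isEquivalent_kernel_comp {α lam : ℝ} (hα0 : 0 < α) (hα1 : α < 1) (hlam : 0 < lam)
    {u ψ : ℝ → ℝ} (hψ : Tendsto ψ atTop atTop) (hu : u ~[atTop] ψ) :
    (fun t => u t ^ (α - 1) * mittagLeffler α α (-lam * u t ^ α)) ~[atTop]
      fun t => -1 / (Real.Gamma (-α) * lam ^ 2) * ψ t ^ (-(1 + α)) :=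
  ((isEquivalent_rpow_mul_mittagLeffler hα0 hα1 hlam).comp_tendsto
    (hu.symm.tendsto_atTop hψ)).trans
    (IsEquivalent.refl.mul (isEquivalent_rpow_of_tendsto_atTop hψ hu))

theorem isBigO_of_isEquivalent_rpow {K ψ g : ℝ → ℝ} {C p : ℝ} (hg : Tendsto g atTop atTop)
    (hK : K ~[atTop] fun t => C * ψ t ^ p) (hψg : ψ ~[atTop] g) :
    K =O[atTop] fun t => g t ^ p :=
  (hK.isBigO.trans (isBigO_const_mul_self C _ _)).trans
    (isEquivalent_rpow_of_tendsto_atTop hg hψg).isBigO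

theorem isBigO_of_isEquivalent_exp {K ψ : ℝ → ℝ} {C p γ : ℝ} (hγ : 0 < γ)
    (hK : K ~[atTop] fun t => C * ψ t ^ p) (hψ : ψ ~[atTop] fun t => Real.exp (γ * t)) :
    K =O[atTop] fun t => Real.exp (p * γ * t) := by
  have h := isBigO_of_isEquivalent_rpow
    (Real.tendsto_exp_atTop.comp (tendsto_id.const_mul_atTop hγ)) hK hψ
  refine h.congr_right fun t => ?_
  rw [Function.comp, ← Real.exp_mul, id]
  congr 1; ring

theorem corollary4p5 (α lam : ℝ) (hα0 : 0 < α) (hα1 : α < 1) (hlam : 0 < lam)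
    (ψ : ℝ → ℝ) (hψ : Tendsto ψ atTop atTop) :
    ∃ C : ℝ, C = -1 / (Real.Gamma (-α) * lam ^ 2) ∧ 0 < C ∧
      -- the kernel `K(t, 0)`
      ((fun t => memoryKernel α lam ψ t 0) ~[atTop] (fun t => C * ψ t ^ (-(1 + α)))) ∧
      ((ψ ~[atTop] (fun t => t)) →
        (fun t => memoryKernel α lam ψ t 0) =O[atTop] (fun t => t ^ (-(1 + α)))) ∧
      (∀ γ : ℝ, 0 < γ → (ψ ~[atTop] (fun t => Real.exp (γ * t))) →
        (fun t => memoryKernel α lam ψ t 0) =O[atTop]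
          (fun t => Real.exp (-(1 + α) * γ * t))) ∧
      -- the profile `ψ(t) ^ (α - 1) * E_{α,α}(-lam * ψ(t) ^ α)`, equal to `K(t, 0)` if `ψ(0) = 0`
      ((fun t => ψ t ^ (α - 1) * mittagLeffler α α (-lam * ψ t ^ α)) ~[atTop]
        (fun t => C * ψ t ^ (-(1 + α)))) ∧
      ((ψ ~[atTop] (fun t => t)) →
        (fun t => ψ t ^ (α - 1) * mittagLeffler α α (-lam * ψ t ^ α)) =O[atTop]
          (fun t => t ^ (-(1 + α)))) ∧
      (∀ γ : ℝ, 0 < γ → (ψ ~[atTop] (fun t => Real.exp (γ * t))) →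
        (fun t => ψ t ^ (α - 1) * mittagLeffler α α (-lam * ψ t ^ α)) =O[atTop]
          (fun t => Real.exp (-(1 + α) * γ * t))) := by
  have hK : (fun t => memoryKernel α lam ψ t 0) ~[atTop]
      fun t => -1 / (Real.Gamma (-α) * lam ^ 2) * ψ t ^ (-(1 + α)) := by
    refine isEquivalent_kernel_comp hα0 hα1 hlam hψ (u := fun t => ψ t - ψ 0) ?_
    refine IsEquivalent.refl.sub_isLittleO (isLittleO_const_left.2 (Or.inr ?_))
    exact tendsto_norm_atTop_atTop.comp hψ
  have hP := isEquivalent_kernel_comp hα0 hα1 hlam hψ (IsEquivalent.refl (u := ψ))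
  refine ⟨_, rfl, ?_, hK, isBigO_of_isEquivalent_rpow tendsto_id hK,
    fun γ hγ => isBigO_of_isEquivalent_exp hγ hK, hP, isBigO_of_isEquivalent_rpow tendsto_id hP,
    fun γ hγ => isBigO_of_isEquivalent_exp hγ hP⟩
  rw [← div_div]
  exact div_pos (neg_one_div_Gamma_neg_pos hα0 hα1) (by positivity)
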